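/- Define $u(n)$ for $n\ge 0$ by $$u(n)=\prod_{i=1}^{n}(4i-1)^2-\sum_{m=0}^{n-1}\binom{2n+1}{2m+1}\Big(\prod_{i=1}^{n-m}(4i-3)^2\Big)u(m)$$ (so $u(0)=1$), define $v(n)$ by $v(0)=1$ and, for $n\ge 1$, $$v(n)=2^{n-1}\prod_{i=1}^{n}(4i-3)^2-\frac12\sum_{m=1}^{n-1}\binom{2n}{2m}v(m)v(n-m),$$ put $$s(n,k)=\frac{(2n)!}{(2k)!}\,[z^{2n}]\Big(\sum_{j\ge 0}\frac{u(j)}{(2j+1)!}z^{2j+1}\Big)^{2k},$$ where $[z^{2n}]$ denotes the coefficient of $z^{2n}$, and define, for $n\ge 0$, $$d(n)=v(n)-\sum_{k=1}^{n-1}2^{n-k}s(n,k)d(k).$$ (These $d(n)$ are Romik's normalized Taylor coefficients of the Jacobi theta function $\theta_3$ at $1$.) Then every $d(n)$ is an integer, and for every prime $p\equiv 1\pmod 4$ and every $n\ge 1$, $$d\left(n+\frac{(p-1)^2}{2}\right)\equiv d(n)\pmod p.$$ That is, the sequence $(d(n))_{n\ge 1}$ modulo $p$ is periodic, and $\frac{(p-1)^2}{2}$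 is a (not necessarily minimal) period. -/

import Mathlib

/-- The integers `u(n)`, given by
`u(n) = 3² 7² ⋯ (4n-1)² - ∑_{m=0}^{n-1} C(2n+1, 2m+1) 1² 5² ⋯ (4(n-m)-3)² u(m)`;
for `n = 0` this reads `u(0) = 1`. -/
def romikU (n : ℕ) : ℤ :=
  (∏ i ∈ Finset.range n, (4 * (i : ℤ) + 3) ^ 2) -
    ∑ m ∈ (Finset.range n).attach,
      (Nat.choose (2 * n + 1) (2 * m.1 + 1) : ℤ) *
        (∏ i ∈ Finset.range (n - m.1), (4 * (i : ℤ) + 1) ^ 2) * romikU m.1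
termination_by n
decreasing_by exact Finset.mem_range.mp m.2

/-- The numbers `v(n)`, given by `v(0) = 1` and, for `n ≥ 1`,
`v(n) = 2^(n-1) 1² 5² ⋯ (4n-3)² - (1/2) ∑_{m=1}^{n-1} C(2n, 2m) v(m) v(n-m)`. -/
def romikV (n : ℕ) : ℚ :=
  if n = 0 then 1 else
    2 ^ (n - 1) * (∏ i ∈ Finset.range n, (4 * (i : ℚ) + 1) ^ 2) -
      1 / 2 * ∑ m ∈ (Finset.Ico 1 n).attach,
        (Nat.choose (2 * n) (2 * m.1) : ℚ) * romikV m.1 * romikV (n - m.1)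
termination_by n
decreasing_by
  · exact (Finset.mem_Ico.mp m.2).2
  · have h := Finset.mem_Ico.mp m.2
    omega

/-- The formal power series `∑_{j ≥ 0} u(j) / (2j+1)! z^(2j+1)`. -/
noncomputable def romikUSeries : PowerSeries ℚ :=
  PowerSeries.mk fun i =>
    if i % 2 = 1 then (romikU (i / 2) : ℚ) / (Nat.factorial i : ℚ) else 0

/-- `s(n,k) = (2n)! / (2k)! · [z^(2n)] (∑_{j ≥ 0} u(j) / (2j+1)! z^(2j+1))^(2k)`. -/
noncomputable def romikS (n k : ℕ) : ℚ :=
  (Nat.factorial (2 * n) : ℚ) / (Nat.factorial (2 * k) : ℚ) *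
    PowerSeries.coeff (2 * n) (romikUSeries ^ (2 * k))

/-- The coefficients `d(n) = v(n) - ∑_{k=1}^{n-1} 2^(n-k) s(n,k) d(k)`. -/
noncomputable def romikD (n : ℕ) : ℚ :=
  romikV n - ∑ k ∈ (Finset.Ico 1 n).attach, 2 ^ (n - k.1) * romikS n k.1 * romikD k.1
termination_by n
decreasing_by exact (Finset.mem_Ico.mp k.2).2

theorem romikU_eq (n : ℕ) :
    romikU n = (∏ i ∈ Finset.range n, (4 * (i : ℤ) + 3) ^ 2) -
      ∑ m ∈ Finset.range n, (Nat.choose (2 * n + 1) (2 * m + 1) : ℤ) *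
        (∏ i ∈ Finset.range (n - m), (4 * (i : ℤ) + 1) ^ 2) * romikU m := by
  rw [romikU, Finset.sum_attach (Finset.range n) fun m =>
    (Nat.choose (2 * n + 1) (2 * m + 1) : ℤ) *
      (∏ i ∈ Finset.range (n - m), (4 * (i : ℤ) + 1) ^ 2) * romikU m]

theorem romikV_zero : romikV 0 = 1 := by
  rw [romikV, if_pos rfl]

theorem romikV_eq (n : ℕ) (hn : 1 ≤ n) :
    romikV n = 2 ^ (n - 1) * (∏ i ∈ Finset.range n, (4 * (i : ℚ) + 1) ^ 2) -
      1 / 2 * ∑ m ∈ Finset.Ico 1 n,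
        (Nat.choose (2 * n) (2 * m) : ℚ) * romikV m * romikV (n - m) := by
  rw [romikV, if_neg (by omega), Finset.sum_attach (Finset.Ico 1 n) fun m =>
    (Nat.choose (2 * n) (2 * m) : ℚ) * romikV m * romikV (n - m)]

theorem romikD_eq (n : ℕ) :
    romikD n = romikV n - ∑ k ∈ Finset.Ico 1 n, 2 ^ (n - k) * romikS n k * romikD k := by
  rw [romikD, Finset.sum_attach (Finset.Ico 1 n) fun k =>
    2 ^ (n - k) * romikS n k * romikD k]

/-! Write `A`, `B`, `V`, `W` for the four `romik…Series` and `f` for `romikField`. The recursions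
for `v` and `u` say `V ^ 2 = B` and `W * B = A`. Both `A` and `B` solve one hypergeometric equation,
so their Wronskian is explicit and `dX/dW = f = (1 - 8 X ^ 2) V ^ 4`. Hence `D = f d/dX` is
differentiation with respect to `W`. The recursion for `d` is the expansion of `V` in powers of `W`,
so `d(n)` is the value of `D ^ (2n) V` at the origin (`localCoeff_romikVSeries`). Since `V`, and
therefore `f`, has integral divided coefficients, so does every `D ^ k V`: the `d(n)` are integers.

For `p ≡ 1 mod 4` the divided coefficients of `V` from order `p` on vanish mod `p`, and `D`
preserves this. Mod `p` at the origin, `D ^ p x` is `x_p + c x_1`, where `x_i` is the `i`-th divided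
coefficient and `c` the value of `D ^ p X` (`localCoeff_prime_modEq`). Taking `x = D ^ (2n-1) V`,
where `x_p` vanishes mod `p`, gives `d(n + (p-1)/2) ≡ c d(n)`. Taking `x = W`, where `D ^ p W = 0`,
shows that `c` is a unit mod `p`. Iterating `p - 1` times, Fermat's little theorem removes `c`. -/

/-! ### Divided coefficients of power series. -/

open PowerSeries in
/-- The coefficient of `X ^ n / n!` in a power series. -/
noncomputable def dividedCoeff (n : ℕ) : PowerSeries ℚ →ₗ[ℚ] ℚ :=
  (n.factorial : ℚ) • coeff n

open PowerSeries in
theorem dividedCoeff_apply (n : ℕ) (x : PowerSeries ℚ) :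
    dividedCoeff n x = n.factorial * coeff n x := rfl

open PowerSeries in
theorem coeff_eq_dividedCoeff_div (n : ℕ) (x : PowerSeries ℚ) :
    coeff n x = dividedCoeff n x / n.factorial := by
  rw [dividedCoeff_apply, mul_div_cancel_left₀ _ (by positivity)]

open PowerSeries in
theorem dividedCoeff_zero (x : PowerSeries ℚ) : dividedCoeff 0 x = constantCoeff x := by
  simp [dividedCoeff_apply]

open PowerSeries in
theorem dividedCoeff_derivative (n : ℕ) (x : PowerSeries ℚ) :
    dividedCoeff n (d⁄dX ℚ x) = dividedCoeff (n + 1) x := by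
  rw [dividedCoeff_apply, dividedCoeff_apply, coeff_derivative, Nat.factorial_succ]
  push_cast
  ring

open PowerSeries in
theorem dividedCoeff_mul (n : ℕ) (x y : PowerSeries ℚ) :
    dividedCoeff n (x * y) = ∑ ij ∈ Finset.HasAntidiagonal.antidiagonal n,
      (n.choose ij.1 : ℚ) * dividedCoeff ij.1 x * dividedCoeff ij.2 y := by
  rw [dividedCoeff_apply, coeff_mul, Finset.mul_sum]
  refine Finset.sum_congr rfl fun ij hij => ?_
  rw [Finset.HasAntidiagonal.mem_antidiagonal] at hij
  subst hij
  simp only [dividedCoeff_apply]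
  have h := Nat.add_choose_mul_factorial_mul_factorial ij.1 ij.2
  rw [← Nat.choose_symm_add] at h
  rw [← h]
  push_cast
  ring

theorem dividedCoeff_one (n : ℕ) : dividedCoeff n 1 = if n = 0 then 1 else 0 := by
  rw [dividedCoeff_apply, PowerSeries.coeff_one]
  split_ifs with h <;> simp [h]

theorem dividedCoeff_X (n : ℕ) : dividedCoeff n PowerSeries.X = if n = 1 then 1 else 0 := by
  rw [dividedCoeff_apply, PowerSeries.coeff_X]
  split_ifs with h <;> simp [h]

theorem dividedCoeff_X_pow_div_factorial (m n : ℕ) :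
    dividedCoeff n ((1 / (m.factorial : ℚ)) • (PowerSeries.X : PowerSeries ℚ) ^ m) =
      if n = m then 1 else 0 := by
  rw [dividedCoeff_apply, map_smul, PowerSeries.coeff_X_pow, smul_eq_mul]
  split_ifs with h
  · subst h
    have : (n.factorial : ℚ) ≠ 0 := by positivity
    field_simp
  · simp

/-! ### Integrality and divisibility by `m`, as membership in the subgroups `ℤ` and `mℤ` of `ℚ`. -/

theorem mul_mem_zmultiples_intCast {q r : ℚ} {m : ℤ}
    (hq : q ∈ AddSubgroup.zmultiples (1 : ℚ)) (hr : r ∈ AddSubgroup.zmultiples (m : ℚ)) :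
    q * r ∈ AddSubgroup.zmultiples (m : ℚ) := by
  obtain ⟨a, rfl⟩ := AddSubgroup.mem_zmultiples_iff.mp hq
  obtain ⟨b, rfl⟩ := AddSubgroup.mem_zmultiples_iff.mp hr
  exact AddSubgroup.mem_zmultiples_iff.mpr ⟨a * b, by simp [mul_assoc]⟩

theorem intCast_mem_zmultiples_intCast {a m : ℤ} :
    (a : ℚ) ∈ AddSubgroup.zmultiples (m : ℚ) ↔ m ∣ a := by
  rw [AddSubgroup.mem_zmultiples_iff]
  constructor
  · rintro ⟨k, hk⟩
    refine ⟨k, ?_⟩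
    rw [zsmul_eq_mul] at hk
    exact_mod_cast (hk.symm.trans (mul_comm _ _))
  · rintro ⟨k, rfl⟩
    exact ⟨k, by push_cast; rw [zsmul_eq_mul, mul_comm]⟩

theorem mem_zmultiples_one_iff {q : ℚ} :
    q ∈ AddSubgroup.zmultiples (1 : ℚ) ↔ ∃ a : ℤ, (a : ℚ) = q := by
  simp [AddSubgroup.mem_zmultiples_iff]

theorem intCast_mem_zmultiples_one (a : ℤ) : (a : ℚ) ∈ AddSubgroup.zmultiples (1 : ℚ) :=
  mem_zmultiples_one_iff.mpr ⟨a, rfl⟩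

theorem natCast_mem_zmultiples_one (a : ℕ) : (a : ℚ) ∈ AddSubgroup.zmultiples (1 : ℚ) := by
  exact_mod_cast intCast_mem_zmultiples_one a

theorem mul_mem_zmultiples_one {q r : ℚ} (hq : q ∈ AddSubgroup.zmultiples (1 : ℚ))
    (hr : r ∈ AddSubgroup.zmultiples (1 : ℚ)) : q * r ∈ AddSubgroup.zmultiples (1 : ℚ) := by
  obtain ⟨a, rfl⟩ := mem_zmultiples_one_iff.mp hq
  obtain ⟨b, rfl⟩ := mem_zmultiples_one_iff.mp hr
  exact_mod_cast intCast_mem_zmultiples_one (a * b)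

/-! ### Rings of Hurwitz series stable under differentiation. -/

/-- Power series `∑ a n / n! X ^ n` with integral `a n`. -/
def hurwitzSubring : Subring (PowerSeries ℚ) where
  carrier := {x | ∀ n, dividedCoeff n x ∈ AddSubgroup.zmultiples (1 : ℚ)}
  zero_mem' n := by rw [map_zero]; exact zero_mem _
  add_mem' hx hy n := by rw [map_add]; exact add_mem (hx n) (hy n)
  neg_mem' hx n := by rw [map_neg]; exact neg_mem (hx n)
  one_mem' n := by
    rw [dividedCoeff_one]
    split_ifs
    exacts [AddSubgroup.mem_zmultiples _, zero_mem _]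
  mul_mem' hx hy n := by
    rw [dividedCoeff_mul]
    refine sum_mem fun ij _ => ?_
    exact mul_mem_zmultiples_one
      (mul_mem_zmultiples_one (natCast_mem_zmultiples_one _) (hx ij.1)) (hy ij.2)

/-- Hurwitz series `∑ a n / n! X ^ n` with `p ∣ a n` for all `n ≥ p`. -/
def truncatedHurwitzSubring (p : ℕ) [hp : Fact p.Prime] : Subring (PowerSeries ℚ) where
  carrier := {x | x ∈ hurwitzSubring ∧
    ∀ n, p ≤ n → dividedCoeff n x ∈ AddSubgroup.zmultiples (((p : ℤ) : ℚ))}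
  zero_mem' := ⟨zero_mem _, fun n _ => by rw [map_zero]; exact zero_mem _⟩
  add_mem' hx hy := ⟨add_mem hx.1 hy.1,
    fun n hn => by rw [map_add]; exact add_mem (hx.2 n hn) (hy.2 n hn)⟩
  neg_mem' hx := ⟨neg_mem hx.1, fun n hn => by rw [map_neg]; exact neg_mem (hx.2 n hn)⟩
  one_mem' := ⟨one_mem _, fun n hn => by
    rw [dividedCoeff_one, if_neg (by have := hp.out.pos; omega)]
    exact zero_mem _⟩
  mul_mem' {x y} hx hy := ⟨mul_mem hx.1 hy.1, fun n hn => by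
    rw [dividedCoeff_mul]
    refine sum_mem fun ij hij => ?_
    rw [Finset.HasAntidiagonal.mem_antidiagonal] at hij
    have hc := natCast_mem_zmultiples_one (n.choose ij.1)
    rw [mul_assoc]
    by_cases h1 : p ≤ ij.1
    · refine mul_mem_zmultiples_intCast hc ?_
      rw [mul_comm]
      exact mul_mem_zmultiples_intCast (hy.1 _) (hx.2 _ h1)
    by_cases h2 : p ≤ ij.2
    · exact mul_mem_zmultiples_intCast hc (mul_mem_zmultiples_intCast (hx.1 _) (hy.2 _ h2))
    -- Two indices below `p` with sum at least `p`: the addition carries in base `p`, so `p` divides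
    -- the binomial.
    · have hd : (p : ℤ) ∣ n.choose ij.1 := by
        have := hp.out.dvd_choose_add (not_le.mp h1) (not_le.mp h2) (by omega)
        rw [hij] at this
        exact_mod_cast this
      rw [mul_comm]
      refine mul_mem_zmultiples_intCast ?_
        (by exact_mod_cast intCast_mem_zmultiples_intCast.mpr hd)
      exact mul_mem_zmultiples_one (hx.1 ij.1) (hy.1 ij.2)⟩

open PowerSeries in
theorem derivative_mem_hurwitzSubring {x : PowerSeries ℚ} (hx : x ∈ hurwitzSubring) :
    d⁄dX ℚ x ∈ hurwitzSubring := fun n => by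
  rw [dividedCoeff_derivative]
  exact hx _

open PowerSeries in
theorem derivative_mem_truncatedHurwitzSubring {p : ℕ} [Fact p.Prime] {x : PowerSeries ℚ}
    (hx : x ∈ truncatedHurwitzSubring p) : d⁄dX ℚ x ∈ truncatedHurwitzSubring p :=
  ⟨derivative_mem_hurwitzSubring hx.1, fun n hn => by
    rw [dividedCoeff_derivative]
    exact hx.2 _ (by omega)⟩

theorem X_mem_hurwitzSubring : (PowerSeries.X : PowerSeries ℚ) ∈ hurwitzSubring := fun n => by
  rw [dividedCoeff_X]
  split_ifs
  exacts [AddSubgroup.mem_zmultiples _, zero_mem _]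

theorem X_mem_truncatedHurwitzSubring (p : ℕ) [hp : Fact p.Prime] :
    (PowerSeries.X : PowerSeries ℚ) ∈ truncatedHurwitzSubring p :=
  ⟨X_mem_hurwitzSubring, fun n hn => by
    rw [dividedCoeff_X, if_neg (by have := hp.out.one_lt; omega)]
    exact zero_mem _⟩

/-! ### Iterates of `f d/dX` at the origin. -/

theorem Derivation.iterate_apply_mul {R A : Type*} [CommSemiring R] [CommRing A] [Algebra R A]
    (D : Derivation R A A) (n : ℕ) (a b : A) :
    D^[n] (a * b) = ∑ ij ∈ Finset.HasAntidiagonal.antidiagonal n, (n.choose ij.1 : A) * (D^[ij.1] a * D^[ij.2] b) := by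
  induction n with
  | zero => simp
  | succ n ih =>
    rw [Finset.sum_antidiagonal_choose_succ_mul (fun i j => D^[i] a * D^[j] b) n,
      Function.iterate_succ_apply', ih, map_sum, ← Finset.sum_add_distrib]
    refine Finset.sum_congr rfl fun ij hij => ?_
    rw [Derivation.leibniz, Derivation.map_natCast, Derivation.leibniz]
    simp only [Function.iterate_succ_apply', smul_eq_mul, mul_zero, add_zero]
    have : n.choose ij.2 = n.choose ij.1 := by
      rw [Finset.HasAntidiagonal.mem_antidiagonal] at hij
      exact Nat.choose_symm_of_eq_add (by omega)
    rw [this]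
    ring

-- Each application lowers the order in `X` by one, producing the exponent and a factor `f`. In
-- particular the `n`-th iterate sees only the series modulo `X ^ (n + 1)`.
open PowerSeries in
theorem constantCoeff_iterate_X_pow_mul (f : PowerSeries ℚ) (n : ℕ) (y : PowerSeries ℚ) :
    constantCoeff ((⇑(f • d⁄dX ℚ))^[n] (X ^ n * y)) =
      n.factorial * constantCoeff f ^ n * constantCoeff y := by
  induction n generalizing y with
  | zero => simp
  | succ n ih =>
    have h : (f • d⁄dX ℚ) (X ^ (n + 1) * y) =
        X ^ n * (((n : PowerSeries ℚ) + 1) * f * y + X * (f • d⁄dX ℚ) y) := by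
      simp only [Derivation.smul_apply, Derivation.leibniz, Derivation.leibniz_pow, derivative_X,
        smul_eq_mul, nsmul_eq_mul, Nat.add_sub_cancel]
      push_cast
      ring
    rw [Function.iterate_succ_apply, h, ih, Nat.factorial_succ]
    simp only [map_add, map_mul, map_natCast, map_one, constantCoeff_X]
    push_cast
    ring

open PowerSeries in
/-- The coefficients, as a Hurwitz series in `w`, of a series after a change of variable from `X`
to `w` with `f = dX / dw`. -/
noncomputable def localCoeff (f : PowerSeries ℚ) (n : ℕ) : PowerSeries ℚ →ₗ[ℚ] ℚ :=
  (coeff 0).comp ((f • d⁄dX ℚ : Derivation ℚ _ _).toLinearMap ^ n)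

open PowerSeries in
theorem localCoeff_apply (f : PowerSeries ℚ) (n : ℕ) (x : PowerSeries ℚ) :
    localCoeff f n x = constantCoeff ((⇑(f • d⁄dX ℚ))^[n] x) := by
  rw [localCoeff, LinearMap.comp_apply, Module.End.pow_apply, coeff_zero_eq_constantCoeff_apply]
  rfl

open PowerSeries in
theorem localCoeff_X_pow_mul (f : PowerSeries ℚ) (n : ℕ) (y : PowerSeries ℚ) :
    localCoeff f n (X ^ n * y) = n.factorial * constantCoeff f ^ n * constantCoeff y := by
  rw [localCoeff_apply, constantCoeff_iterate_X_pow_mul]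

open PowerSeries in
theorem iterate_smul_derivative_mem_hurwitzSubring {f x : PowerSeries ℚ} (hf : f ∈ hurwitzSubring)
    (hx : x ∈ hurwitzSubring) (n : ℕ) : (⇑(f • d⁄dX ℚ))^[n] x ∈ hurwitzSubring := by
  induction n with
  | zero => exact hx
  | succ n ih =>
    rw [Function.iterate_succ_apply']
    exact mul_mem hf (derivative_mem_hurwitzSubring ih)

open PowerSeries in
theorem iterate_smul_derivative_mem_truncatedHurwitzSubring {p : ℕ} [Fact p.Prime]
    {f x : PowerSeries ℚ} (hf : f ∈ truncatedHurwitzSubring p)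
    (hx : x ∈ truncatedHurwitzSubring p) (n : ℕ) :
    (⇑(f • d⁄dX ℚ))^[n] x ∈ truncatedHurwitzSubring p := by
  induction n with
  | zero => exact hx
  | succ n ih =>
    rw [Function.iterate_succ_apply']
    exact mul_mem hf (derivative_mem_truncatedHurwitzSubring ih)

theorem localCoeff_mem_zmultiples_one {f x : PowerSeries ℚ} (hf : f ∈ hurwitzSubring)
    (hx : x ∈ hurwitzSubring) (n : ℕ) : localCoeff f n x ∈ AddSubgroup.zmultiples (1 : ℚ) := by
  rw [localCoeff_apply, ← dividedCoeff_zero]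
  exact iterate_smul_derivative_mem_hurwitzSubring hf hx n 0

theorem localCoeff_mul (f : PowerSeries ℚ) (n : ℕ) (x y : PowerSeries ℚ) :
    localCoeff f n (x * y) = ∑ ij ∈ Finset.HasAntidiagonal.antidiagonal n,
      (n.choose ij.1 : ℚ) * (localCoeff f ij.1 x * localCoeff f ij.2 y) := by
  simp only [localCoeff_apply, Derivation.iterate_apply_mul, map_sum, map_mul, map_natCast]

theorem localCoeff_zero_X_pow (f : PowerSeries ℚ) {m : ℕ} (hm : m ≠ 0) :
    localCoeff f 0 (PowerSeries.X ^ m) = 0 := by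
  simp [localCoeff_apply, hm]

/-! ### The `p`-th iterate modulo `p`. -/

/-- Apply Leibniz to `X ^ (m - 1) * X`: the two end terms vanish because both factors vanish at the
origin, and `p` divides every other binomial. -/
theorem localCoeff_prime_X_pow {f : PowerSeries ℚ} (hf : f ∈ hurwitzSubring) {p : ℕ}
    (hp : p.Prime) {m : ℕ} (hm : 2 ≤ m) :
    localCoeff f p (PowerSeries.X ^ m) ∈ AddSubgroup.zmultiples ((p : ℤ) : ℚ) := by
  obtain ⟨m, rfl⟩ := Nat.exists_eq_add_of_le' hm
  rw [show m + 2 = (m + 1) + 1 by rfl, pow_succ, localCoeff_mul]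
  refine sum_mem fun ij hij => ?_
  rw [Finset.HasAntidiagonal.mem_antidiagonal] at hij
  by_cases h0 : ij.1 = 0
  · rw [h0, localCoeff_zero_X_pow f (by omega)]
    simp
  by_cases h1 : ij.2 = 0
  · rw [h1, ← pow_one PowerSeries.X, localCoeff_zero_X_pow f (by omega)]
    simp
  rw [mul_comm]
  have hd : (p : ℤ) ∣ p.choose ij.1 := by
    exact_mod_cast hp.dvd_choose_self h0 (by omega)
  refine mul_mem_zmultiples_intCast ?_ (by exact_mod_cast intCast_mem_zmultiples_intCast.mpr hd)
  exact mul_mem_zmultiples_one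
    (localCoeff_mem_zmultiples_one hf (pow_mem X_mem_hurwitzSubring (m + 1)) ij.1)
    (localCoeff_mem_zmultiples_one hf X_mem_hurwitzSubring ij.2)

theorem localCoeff_one_right (f : PowerSeries ℚ) {n : ℕ} (hn : n ≠ 0) : localCoeff f n 1 = 0 := by
  obtain ⟨n, rfl⟩ := Nat.exists_eq_succ_of_ne_zero hn
  rw [localCoeff_apply, Function.iterate_succ_apply, Derivation.map_one_eq_zero,
    iterate_map_zero, map_zero]

theorem X_pow_div_factorial_mem_hurwitzSubring (m : ℕ) :
    (1 / (m.factorial : ℚ)) • (PowerSeries.X : PowerSeries ℚ) ^ m ∈ hurwitzSubring := fun n => by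
  rw [dividedCoeff_X_pow_div_factorial]
  split_ifs
  exacts [AddSubgroup.mem_zmultiples _, zero_mem _]

/-- The value is already an integer, and `m!` is prime to `p`, so divisibility survives division by
`m!`. -/
theorem localCoeff_prime_X_pow_div_factorial {f : PowerSeries ℚ} (hf : f ∈ hurwitzSubring) {p : ℕ}
    (hp : p.Prime) {m : ℕ} (hm : 2 ≤ m) (hmp : m < p) :
    localCoeff f p ((1 / (m.factorial : ℚ)) • PowerSeries.X ^ m) ∈
      AddSubgroup.zmultiples ((p : ℤ) : ℚ) := by
  obtain ⟨a, ha⟩ := mem_zmultiples_one_iff.mp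
    (localCoeff_mem_zmultiples_one hf (X_pow_div_factorial_mem_hurwitzSubring m) p)
  have h := localCoeff_prime_X_pow hf hp hm
  have hfac : (m.factorial : ℚ) ≠ 0 := by positivity
  have h2 : localCoeff f p (PowerSeries.X ^ m) = ((m.factorial * a : ℤ) : ℚ) := by
    push_cast
    rw [ha, map_smul, smul_eq_mul]
    field_simp
  rw [h2, intCast_mem_zmultiples_intCast] at h
  rw [← ha, intCast_mem_zmultiples_intCast]
  refine ((Nat.prime_iff_prime_int.mp hp).dvd_or_dvd h).resolve_left fun hd => ?_
  have hd' : p ∣ m.factorial := by exact_mod_cast hd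
  exact absurd ((hp.dvd_factorial).mp hd') (by omega)

open PowerSeries in
theorem exists_eq_sum_X_pow_div_factorial_add (x : PowerSeries ℚ) (n : ℕ) :
    ∃ y, x = ∑ m ∈ Finset.range n, dividedCoeff m x • ((1 / (m.factorial : ℚ)) • X ^ m) +
      X ^ n * y := by
  suffices h : X ^ n ∣
      x - ∑ m ∈ Finset.range n, dividedCoeff m x • ((1 / (m.factorial : ℚ)) • X ^ m) by
    obtain ⟨y, hy⟩ := h
    exact ⟨y, by rw [← hy]; ring⟩
  rw [X_pow_dvd_iff]
  intro m hm
  rw [map_sub, sub_eq_zero, map_sum, Finset.sum_eq_single m]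
  · simp [coeff_eq_dividedCoeff_div, div_eq_mul_inv, coeff_X_pow]
  · intro b _ hb
    simp [coeff_X_pow, hb.symm]
  · intro h
    exact absurd (Finset.mem_range.mpr hm) h

/-- Modulo `p`, the `p`-th iterate of a derivation of the ring of Hurwitz series is determined at
the origin by its value at `X` and its divided coefficient of order `p`. -/
theorem localCoeff_prime_modEq {f : PowerSeries ℚ} (hf : f ∈ hurwitzSubring)
    (hf0 : PowerSeries.constantCoeff f = 1) {p : ℕ} (hp : p.Prime) {x : PowerSeries ℚ}
    (hx : x ∈ hurwitzSubring) :
    localCoeff f p x - dividedCoeff p x - dividedCoeff 1 x * localCoeff f p PowerSeries.X ∈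
      AddSubgroup.zmultiples ((p : ℤ) : ℚ) := by
  obtain ⟨y, hy⟩ := exists_eq_sum_X_pow_div_factorial_add x (p + 1)
  have hp2 := hp.two_le
  obtain ⟨q, rfl⟩ := Nat.exists_eq_add_of_le' hp2
  have hlast : localCoeff f (q + 2) (PowerSeries.X ^ (q + 2 + 1) * y) = 0 := by
    rw [pow_succ, mul_assoc, localCoeff_X_pow_mul]
    simp
  have htop : localCoeff f (q + 2) ((1 / ((q + 2).factorial : ℚ)) • PowerSeries.X ^ (q + 2)) = 1 := by
    have hfac : ((q + 2).factorial : ℚ) ≠ 0 := by positivity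
    rw [map_smul, ← mul_one (PowerSeries.X ^ (q + 2)), localCoeff_X_pow_mul, hf0, smul_eq_mul]
    simp [hfac]
  -- Here `p = q + 2`. In the Taylor expansion of `x`, the constant and the tail contribute nothing,
  -- and orders `1` and `p` give the two subtracted terms; orders `2` to `p - 1` remain.
  have key : localCoeff f (q + 2) x - dividedCoeff (q + 2) x -
      dividedCoeff 1 x * localCoeff f (q + 2) PowerSeries.X =
      ∑ m ∈ Finset.range q, dividedCoeff (m + 2) x *
        localCoeff f (q + 2) ((1 / ((m + 2).factorial : ℚ)) • PowerSeries.X ^ (m + 2)) := by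
    conv_lhs => enter [1, 1]; rw [hy]
    rw [map_add, hlast, map_sum, Finset.sum_range_succ, Finset.sum_range_succ',
      Finset.sum_range_succ']
    simp only [map_smul _ (dividedCoeff _ x), smul_eq_mul]
    rw [htop]
    simp only [Nat.factorial, zero_add, pow_one, pow_zero, Nat.cast_one, div_one, one_smul, mul_one,
      localCoeff_one_right f (Nat.succ_ne_zero (q + 1)), mul_zero, add_zero]
    ring
  rw [key]
  refine sum_mem fun m hm => ?_
  rw [Finset.mem_range] at hm
  exact mul_mem_zmultiples_intCast (hx _)
    (localCoeff_prime_X_pow_div_factorial hf hp (by omega) (by omega))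

/-! ### Even and odd series and their products. -/

theorem ext_dividedCoeff {x y : PowerSeries ℚ} (h : ∀ n, dividedCoeff n x = dividedCoeff n y) :
    x = y := by
  ext n
  rw [coeff_eq_dividedCoeff_div, coeff_eq_dividedCoeff_div, h]

theorem dividedCoeff_mk_div_factorial (a : ℕ → ℚ) (n : ℕ) :
    dividedCoeff n (PowerSeries.mk fun i => a i / (i.factorial : ℚ)) = a n := by
  have : (n.factorial : ℚ) ≠ 0 := by positivity
  rw [dividedCoeff_apply, PowerSeries.coeff_mk]
  field_simp

/-- The even series `∑ a n / (2n)! X ^ (2n)`. -/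
noncomputable def evenSeries (a : ℕ → ℚ) : PowerSeries ℚ :=
  PowerSeries.mk fun i => (if i % 2 = 1 then 0 else a (i / 2)) / (i.factorial : ℚ)

/-- The odd series `∑ a n / (2n+1)! X ^ (2n+1)`. -/
noncomputable def oddSeries (a : ℕ → ℚ) : PowerSeries ℚ :=
  PowerSeries.mk fun i => (if i % 2 = 1 then a (i / 2) else 0) / (i.factorial : ℚ)

theorem dividedCoeff_evenSeries_two_mul (a : ℕ → ℚ) (n : ℕ) :
    dividedCoeff (2 * n) (evenSeries a) = a n := by
  rw [evenSeries, dividedCoeff_mk_div_factorial, if_neg (by omega)]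
  congr 1
  omega

theorem dividedCoeff_evenSeries_two_mul_add_one (a : ℕ → ℚ) (n : ℕ) :
    dividedCoeff (2 * n + 1) (evenSeries a) = 0 := by
  rw [evenSeries, dividedCoeff_mk_div_factorial, if_pos (by omega)]

theorem dividedCoeff_oddSeries_two_mul (a : ℕ → ℚ) (n : ℕ) :
    dividedCoeff (2 * n) (oddSeries a) = 0 := by
  rw [oddSeries, dividedCoeff_mk_div_factorial, if_neg (by omega)]

theorem dividedCoeff_oddSeries_two_mul_add_one (a : ℕ → ℚ) (n : ℕ) :
    dividedCoeff (2 * n + 1) (oddSeries a) = a n := by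
  rw [oddSeries, dividedCoeff_mk_div_factorial, if_pos (by omega)]
  congr 1
  omega

theorem sum_range_two_mul {M : Type*} [AddCommMonoid M] (F : ℕ → M) (n : ℕ) :
    ∑ i ∈ Finset.range (2 * n), F i =
      ∑ m ∈ Finset.range n, F (2 * m) + ∑ m ∈ Finset.range n, F (2 * m + 1) := by
  induction n with
  | zero => simp
  | succ n ih =>
    rw [show 2 * (n + 1) = 2 * n + 1 + 1 by ring, Finset.sum_range_succ, Finset.sum_range_succ, ih,
      Finset.sum_range_succ, Finset.sum_range_succ]
    abel

theorem dividedCoeff_mul_range (n : ℕ) (x y : PowerSeries ℚ) :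
    dividedCoeff n (x * y) = ∑ i ∈ Finset.range (n + 1),
      (n.choose i : ℚ) * dividedCoeff i x * dividedCoeff (n - i) y := by
  rw [dividedCoeff_mul, Finset.Nat.sum_antidiagonal_eq_sum_range_succ_mk]

theorem evenSeries_mul_evenSeries (a b : ℕ → ℚ) :
    evenSeries a * evenSeries b = evenSeries fun n =>
      ∑ m ∈ Finset.range (n + 1), ((2 * n).choose (2 * m) : ℚ) * a m * b (n - m) := by
  refine ext_dividedCoeff fun k => ?_
  obtain ⟨n, rfl | rfl⟩ := k.even_or_odd'
  · rw [dividedCoeff_evenSeries_two_mul, dividedCoeff_mul_range, Finset.sum_range_succ,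
      sum_range_two_mul, Finset.sum_range_succ]
    simp only [dividedCoeff_evenSeries_two_mul, dividedCoeff_evenSeries_two_mul_add_one, mul_zero,
      zero_mul, Finset.sum_const_zero, add_zero, ← Nat.mul_sub]
  · rw [dividedCoeff_evenSeries_two_mul_add_one, dividedCoeff_mul_range,
      show 2 * n + 1 + 1 = 2 * (n + 1) by ring, sum_range_two_mul]
    have h : ∀ m ∈ Finset.range (n + 1), ((2 * n + 1).choose (2 * m) : ℚ) *
        dividedCoeff (2 * m) (evenSeries a) * dividedCoeff (2 * n + 1 - 2 * m) (evenSeries b) = 0 := by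
      intro m hm
      rw [Finset.mem_range] at hm
      rw [show 2 * n + 1 - 2 * m = 2 * (n - m) + 1 by omega,
        dividedCoeff_evenSeries_two_mul_add_one, mul_zero]
    rw [Finset.sum_eq_zero h]
    simp [dividedCoeff_evenSeries_two_mul_add_one]

theorem oddSeries_mul_evenSeries (a b : ℕ → ℚ) :
    oddSeries a * evenSeries b = oddSeries fun n =>
      ∑ m ∈ Finset.range (n + 1), ((2 * n + 1).choose (2 * m + 1) : ℚ) * a m * b (n - m) := by
  refine ext_dividedCoeff fun k => ?_
  obtain ⟨n, rfl | rfl⟩ := k.even_or_odd'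
  · rw [dividedCoeff_oddSeries_two_mul, dividedCoeff_mul_range, Finset.sum_range_succ,
      sum_range_two_mul]
    have h : ∀ m ∈ Finset.range n, ((2 * n).choose (2 * m + 1) : ℚ) *
        dividedCoeff (2 * m + 1) (oddSeries a) *
          dividedCoeff (2 * n - (2 * m + 1)) (evenSeries b) = 0 := by
      intro m hm
      rw [Finset.mem_range] at hm
      rw [show 2 * n - (2 * m + 1) = 2 * (n - m - 1) + 1 by omega,
        dividedCoeff_evenSeries_two_mul_add_one, mul_zero]
    rw [Finset.sum_eq_zero h]
    simp [dividedCoeff_oddSeries_two_mul]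
  · rw [dividedCoeff_oddSeries_two_mul_add_one, dividedCoeff_mul_range,
      show 2 * n + 1 + 1 = 2 * (n + 1) by ring, sum_range_two_mul]
    simp only [dividedCoeff_oddSeries_two_mul, dividedCoeff_oddSeries_two_mul_add_one, mul_zero,
      zero_mul, Finset.sum_const_zero, zero_add]
    refine Finset.sum_congr rfl fun m hm => ?_
    rw [show 2 * n + 1 - (2 * m + 1) = 2 * (n - m) by omega, dividedCoeff_evenSeries_two_mul]

/-! ### The hypergeometric equation and its Wronskian. -/

open PowerSeries in
theorem dividedCoeff_X_mul_derivative (n : ℕ) (x : PowerSeries ℚ) :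
    dividedCoeff n (X * d⁄dX ℚ x) = n * dividedCoeff n x := by
  rw [dividedCoeff_apply, dividedCoeff_apply]
  cases n with
  | zero => simp
  | succ n =>
    rw [coeff_succ_X_mul, coeff_derivative]
    push_cast
    ring

open PowerSeries in
/-- The hypergeometric differential equation. -/
theorem hypergeometric_equation {x : PowerSeries ℚ}
    (hx : ∀ n : ℕ, dividedCoeff (n + 2) x = 2 * (2 * n + 1) ^ 2 * dividedCoeff n x) :
    (1 - 8 * X ^ 2) * d⁄dX ℚ (d⁄dX ℚ x) = 16 * X * d⁄dX ℚ x + 2 * x := by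
  -- `X d/dX` multiplies the `n`-th coefficient by `n`, and `2 (2n+1)² = 8n² + 8n + 2`.
  have h : d⁄dX ℚ (d⁄dX ℚ x) = (8 : ℚ) • (X * d⁄dX ℚ (X * d⁄dX ℚ x)) +
      (8 : ℚ) • (X * d⁄dX ℚ x) + (2 : ℚ) • x := by
    refine ext_dividedCoeff fun n => ?_
    simp only [map_add, map_smul, dividedCoeff_X_mul_derivative, dividedCoeff_derivative, hx,
      smul_eq_mul]
    ring
  have h2 : d⁄dX ℚ (X * d⁄dX ℚ x) = X * d⁄dX ℚ (d⁄dX ℚ x) + d⁄dX ℚ x := by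
    simp [Derivation.leibniz]
  rw [h2] at h
  simp only [← map_ofNat (algebraMap ℚ ℚ⟦X⟧), Algebra.smul_def] at h ⊢
  simp only [map_ofNat] at h ⊢
  linear_combination h

-- Abel's identity: by the differential equation the left side has zero derivative, so it equals its
-- constant term.
open PowerSeries in
theorem wronskian_eq_one {A B : PowerSeries ℚ}
    (hA : ∀ n : ℕ, dividedCoeff (n + 2) A = 2 * (2 * n + 1) ^ 2 * dividedCoeff n A)
    (hB : ∀ n : ℕ, dividedCoeff (n + 2) B = 2 * (2 * n + 1) ^ 2 * dividedCoeff n B)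
    (hA0 : dividedCoeff 0 A = 0) (hA1 : dividedCoeff 1 A = 1) (hB0 : dividedCoeff 0 B = 1) :
    (1 - 8 * X ^ 2) * (d⁄dX ℚ A * B - A * d⁄dX ℚ B) = 1 := by
  apply derivative.ext
  · have h8 : d⁄dX ℚ (8 : ℚ⟦X⟧) = 0 := by
      rw [← map_ofNat (algebraMap ℚ ℚ⟦X⟧)]
      exact Derivation.map_algebraMap _ _
    rw [Derivation.map_one_eq_zero]
    simp only [Derivation.leibniz, map_sub, Derivation.map_one_eq_zero, Derivation.leibniz_pow, h8,
      derivative_X, smul_eq_mul, nsmul_eq_mul]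
    push_cast
    linear_combination B * hypergeometric_equation hA - A * hypergeometric_equation hB
  · have h : constantCoeff (d⁄dX ℚ A) = 1 := by
      rw [← dividedCoeff_zero, dividedCoeff_derivative, hA1]
    rw [dividedCoeff_zero] at hA0 hB0
    simp [h, hA0, hB0]

/-! ### Romik's series and the uniformizer `W`. -/

/-- `∑ 2^n ∏ (4i+1)^2 / (2n)! X^(2n)`. -/
noncomputable def romikBSeries : PowerSeries ℚ :=
  evenSeries fun n => 2 ^ n * ∏ i ∈ Finset.range n, (4 * (i : ℚ) + 1) ^ 2

/-- `∑ 2^n ∏ (4i+3)^2 / (2n+1)! X^(2n+1)`. -/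
noncomputable def romikASeries : PowerSeries ℚ :=
  oddSeries fun n => 2 ^ n * ∏ i ∈ Finset.range n, (4 * (i : ℚ) + 3) ^ 2

/-- `∑ v(n) / (2n)! X^(2n)`. -/
noncomputable def romikVSeries : PowerSeries ℚ := evenSeries romikV

/-- `∑ 2^n u(n) / (2n+1)! X^(2n+1)`. -/
noncomputable def romikWSeries : PowerSeries ℚ := oddSeries fun n => 2 ^ n * (romikU n : ℚ)

theorem dividedCoeff_romikBSeries_add_two (n : ℕ) : dividedCoeff (n + 2) romikBSeries =
    2 * (2 * n + 1) ^ 2 * dividedCoeff n romikBSeries := by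
  rw [romikBSeries]
  obtain ⟨m, rfl | rfl⟩ := n.even_or_odd'
  · rw [show 2 * m + 2 = 2 * (m + 1) by ring, dividedCoeff_evenSeries_two_mul,
      dividedCoeff_evenSeries_two_mul, Finset.prod_range_succ]
    push_cast
    ring
  · rw [show 2 * m + 1 + 2 = 2 * (m + 1) + 1 by ring, dividedCoeff_evenSeries_two_mul_add_one,
      dividedCoeff_evenSeries_two_mul_add_one, mul_zero]

theorem dividedCoeff_romikASeries_add_two (n : ℕ) : dividedCoeff (n + 2) romikASeries =
    2 * (2 * n + 1) ^ 2 * dividedCoeff n romikASeries := by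
  rw [romikASeries]
  obtain ⟨m, rfl | rfl⟩ := n.even_or_odd'
  · rw [show 2 * m + 2 = 2 * (m + 1) by ring, dividedCoeff_oddSeries_two_mul,
      dividedCoeff_oddSeries_two_mul, mul_zero]
  · rw [show 2 * m + 1 + 2 = 2 * (m + 1) + 1 by ring, dividedCoeff_oddSeries_two_mul_add_one,
      dividedCoeff_oddSeries_two_mul_add_one, Finset.prod_range_succ]
    push_cast
    ring

theorem two_mul_romikV {n : ℕ} (hn : 1 ≤ n) :
    2 * romikV n = 2 ^ n * (∏ i ∈ Finset.range n, (4 * (i : ℚ) + 1) ^ 2) -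
      ∑ m ∈ Finset.Ico 1 n, ((2 * n).choose (2 * m) : ℚ) * romikV m * romikV (n - m) := by
  obtain ⟨n, rfl⟩ := Nat.exists_eq_add_of_le' hn
  rw [romikV_eq _ hn, Nat.add_sub_cancel, pow_succ]
  ring

theorem romikVSeries_sq : romikVSeries * romikVSeries = romikBSeries := by
  rw [romikVSeries, evenSeries_mul_evenSeries, romikBSeries]
  congr 1
  funext n
  cases n with
  | zero => simp [romikV_zero]
  | succ n =>
    have h := two_mul_romikV (Nat.succ_pos n)
    rw [Finset.sum_range_succ, Finset.range_eq_Ico, Finset.sum_eq_sum_Ico_succ_bot (by omega)]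
    simp only [Nat.choose_self, mul_zero, Nat.choose_zero_right, romikV_zero, Nat.sub_self,
      Nat.sub_zero, Nat.cast_one, one_mul, mul_one, zero_add, Nat.succ_eq_add_one,
      Finset.range_eq_Ico] at h ⊢
    linear_combination h

theorem romikWSeries_mul_romikBSeries : romikWSeries * romikBSeries = romikASeries := by
  rw [romikWSeries, romikBSeries, oddSeries_mul_evenSeries, romikASeries]
  congr 1
  funext n
  have h : (romikU n : ℚ) = (∏ i ∈ Finset.range n, (4 * (i : ℚ) + 3) ^ 2) -
      ∑ m ∈ Finset.range n, ((2 * n + 1).choose (2 * m + 1) : ℚ) *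
        (∏ i ∈ Finset.range (n - m), (4 * (i : ℚ) + 1) ^ 2) * romikU m := by
    exact_mod_cast congrArg (Int.cast (R := ℚ)) (romikU_eq n)
  have h2 : ∑ m ∈ Finset.range n, ((2 * n + 1).choose (2 * m + 1) : ℚ) * (2 ^ m * (romikU m : ℚ)) *
      (2 ^ (n - m) * ∏ i ∈ Finset.range (n - m), (4 * (i : ℚ) + 1) ^ 2) =
      2 ^ n * ∑ m ∈ Finset.range n, ((2 * n + 1).choose (2 * m + 1) : ℚ) *
        (∏ i ∈ Finset.range (n - m), (4 * (i : ℚ) + 1) ^ 2) * romikU m := by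
    rw [Finset.mul_sum]
    refine Finset.sum_congr rfl fun m hm => ?_
    rw [Finset.mem_range] at hm
    rw [← Nat.add_sub_cancel' hm.le, pow_add, Nat.add_sub_cancel_left]
    ring
  rw [Finset.sum_range_succ, h2, h]
  simp
  ring

open PowerSeries in
/-- The derivative of `X` with respect to the uniformizer `romikWSeries`. -/
noncomputable def romikField : PowerSeries ℚ := (1 - 8 * X ^ 2) * romikVSeries ^ 4

-- Quotient rule for `W = A / B`, with the Wronskian as numerator and `B ^ 2 = V ^ 4` as
-- denominator.
open PowerSeries in
theorem romikField_mul_derivative_romikWSeries : romikField * d⁄dX ℚ romikWSeries = 1 := by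
  have hw := wronskian_eq_one dividedCoeff_romikASeries_add_two dividedCoeff_romikBSeries_add_two
    (dividedCoeff_oddSeries_two_mul _ 0)
    ((dividedCoeff_oddSeries_two_mul_add_one _ 0).trans (by simp))
    ((dividedCoeff_evenSeries_two_mul _ 0).trans (by simp))
  rw [← romikWSeries_mul_romikBSeries] at hw
  simp only [Derivation.leibniz, smul_eq_mul] at hw
  rw [romikField, show romikVSeries ^ 4 = romikBSeries ^ 2 by rw [← romikVSeries_sq]; ring]
  linear_combination hw

theorem constantCoeff_romikVSeries : PowerSeries.constantCoeff romikVSeries = 1 := by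
  rw [← dividedCoeff_zero]
  exact (dividedCoeff_evenSeries_two_mul _ 0).trans romikV_zero

theorem constantCoeff_romikWSeries : PowerSeries.constantCoeff romikWSeries = 0 := by
  rw [← dividedCoeff_zero]
  exact dividedCoeff_oddSeries_two_mul _ 0

theorem constantCoeff_romikField : PowerSeries.constantCoeff romikField = 1 := by
  simp [romikField, constantCoeff_romikVSeries]

/-! ### Integrality of `v` and of the field `f`. -/

theorem even_sum_Ico_of_symm {F : ℕ → ℤ} {n : ℕ} (hF : ∀ m ∈ Finset.Ico 1 n, F (n - m) = F m)
    (hF2 : ∀ m, 1 ≤ m → n = 2 * m → Even (F m)) : Even (∑ m ∈ Finset.Ico 1 n, F m) := by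
  rw [← ZMod.intCast_eq_zero_iff_even, Int.cast_sum]
  refine Finset.sum_involution (fun m _ => n - m) ?_ ?_ ?_ ?_
  · intro m hm
    rw [hF m hm]
    exact CharTwo.add_self_eq_zero _
  · intro m hm h0 he
    rw [Finset.mem_Ico] at hm
    exact h0 (ZMod.intCast_eq_zero_iff_even.mpr (hF2 m hm.1 (by omega)))
  · intro m hm
    rw [Finset.mem_Ico] at hm ⊢
    omega
  · intro m hm
    rw [Finset.mem_Ico] at hm
    omega

/-- The halved sum is even: terms pair off under `m ↦ n - m`, and a middle term carries an even
central binomial coefficient. -/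
theorem exists_intCast_eq_romikV (n : ℕ) : ∃ a : ℤ, (a : ℚ) = romikV n := by
  induction n using Nat.strong_induction_on with
  | _ n ih =>
    rcases Nat.eq_zero_or_pos n with rfl | hn
    · exact ⟨1, by rw [romikV_zero, Int.cast_one]⟩
    have hv : ∀ m < n, ((romikV m).num : ℚ) = romikV m := fun m hm => by
      obtain ⟨a, ha⟩ := ih m hm
      rw [← ha, Rat.num_intCast]
    obtain ⟨b, hb⟩ := even_iff_exists_two_mul.mp (even_sum_Ico_of_symm (n := n)
      (F := fun m => (2 * n).choose (2 * m) * (romikV m).num * (romikV (n - m)).num)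
      (fun m hm => by
        rw [Finset.mem_Ico] at hm
        rw [Nat.sub_sub_self hm.2.le, Nat.mul_sub, Nat.choose_symm (by omega)]
        ring)
      (fun m hm h => by
        subst h
        refine Even.mul_right (Even.mul_right ?_ _) _
        exact_mod_cast even_iff_two_dvd.mpr (Nat.two_dvd_centralBinom_of_one_le (n := 2 * m)
          (by omega))))
    refine ⟨2 ^ (n - 1) * (∏ i ∈ Finset.range n, (4 * (i : ℤ) + 1) ^ 2) - b, ?_⟩
    have hb' : ∑ m ∈ Finset.Ico 1 n, ((2 * n).choose (2 * m) : ℚ) * romikV m * romikV (n - m) =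
        2 * b := by
      rw [← Int.cast_ofNat, ← Int.cast_mul, ← hb, Int.cast_sum]
      refine Finset.sum_congr rfl fun m hm => ?_
      rw [Finset.mem_Ico] at hm
      push_cast
      rw [hv m hm.2, hv (n - m) (by omega)]
    rw [romikV_eq n hn, hb']
    push_cast
    ring

theorem evenSeries_mem_hurwitzSubring {a : ℕ → ℚ}
    (ha : ∀ n, a n ∈ AddSubgroup.zmultiples (1 : ℚ)) : evenSeries a ∈ hurwitzSubring := fun k => by
  obtain ⟨n, rfl | rfl⟩ := k.even_or_odd'
  · rw [dividedCoeff_evenSeries_two_mul]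
    exact ha n
  · rw [dividedCoeff_evenSeries_two_mul_add_one]
    exact zero_mem _

theorem oddSeries_mem_hurwitzSubring {a : ℕ → ℚ}
    (ha : ∀ n, a n ∈ AddSubgroup.zmultiples (1 : ℚ)) : oddSeries a ∈ hurwitzSubring := fun k => by
  obtain ⟨n, rfl | rfl⟩ := k.even_or_odd'
  · rw [dividedCoeff_oddSeries_two_mul]
    exact zero_mem _
  · rw [dividedCoeff_oddSeries_two_mul_add_one]
    exact ha n

theorem romikVSeries_mem_hurwitzSubring : romikVSeries ∈ hurwitzSubring :=
  evenSeries_mem_hurwitzSubring fun n => mem_zmultiples_one_iff.mpr (exists_intCast_eq_romikV n)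

theorem romikWSeries_mem_hurwitzSubring : romikWSeries ∈ hurwitzSubring :=
  oddSeries_mem_hurwitzSubring fun n => by
    exact_mod_cast intCast_mem_zmultiples_one (2 ^ n * romikU n)

theorem romikField_mem {S : Subring (PowerSeries ℚ)} (hX : PowerSeries.X ∈ S)
    (hV : romikVSeries ∈ S) : romikField ∈ S := by
  rw [romikField]
  refine mul_mem (sub_mem (one_mem _) (mul_mem ?_ (pow_mem hX 2))) (pow_mem hV 4)
  exact_mod_cast natCast_mem S 8

theorem romikField_mem_hurwitzSubring : romikField ∈ hurwitzSubring :=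
  romikField_mem X_mem_hurwitzSubring romikVSeries_mem_hurwitzSubring

/-! ### Vanishing of `v` modulo `p`. -/

theorem prime_dvd_prod_four_mul_add_one {p n : ℕ} (hp4 : p ≡ 1 [MOD 4]) (hp1 : 1 < p)
    (hn : p ≤ 2 * n) : (p : ℤ) ∣ ∏ i ∈ Finset.range n, (4 * (i : ℤ) + 1) ^ 2 := by
  have h4 : p % 4 = 1 := hp4
  -- The factor with `i = p / 4` is `p ^ 2`, since `p ≡ 1 mod 4`.
  refine dvd_trans ?_ (Finset.dvd_prod_of_mem _ (Finset.mem_range.mpr (show p / 4 < n by omega)))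
  refine dvd_pow (dvd_of_eq ?_) two_ne_zero
  omega

/-- In the recursion for `2 v(n)` the product is divisible by `p`; in each other term either a
factor `v` is, by induction, or the binomial is. Then cancel `2`, as `p` is odd. -/
theorem prime_dvd_romikV {p : ℕ} (hp : p.Prime) (hp4 : p ≡ 1 [MOD 4]) (n : ℕ) (hn : p ≤ 2 * n) :
    romikV n ∈ AddSubgroup.zmultiples ((p : ℤ) : ℚ) := by
  induction n using Nat.strong_induction_on with
  | _ n ih =>
    have hv : ∀ m, romikV m ∈ AddSubgroup.zmultiples (1 : ℚ) := fun m =>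
      mem_zmultiples_one_iff.mpr (exists_intCast_eq_romikV m)
    have h2 : 2 * romikV n ∈ AddSubgroup.zmultiples ((p : ℤ) : ℚ) := by
      rw [two_mul_romikV (by have := hp.pos; omega)]
      refine sub_mem ?_ (sum_mem fun m hm => ?_)
      · exact_mod_cast intCast_mem_zmultiples_intCast.mpr
          ((prime_dvd_prod_four_mul_add_one hp4 hp.one_lt hn).mul_left (2 ^ n))
      · rw [Finset.mem_Ico] at hm
        have hc := natCast_mem_zmultiples_one ((2 * n).choose (2 * m))
        by_cases h1 : p ≤ 2 * m
        · rw [mul_right_comm]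
          exact mul_mem_zmultiples_intCast (mul_mem_zmultiples_one hc (hv _)) (ih m hm.2 h1)
        by_cases h2 : p ≤ 2 * (n - m)
        · exact mul_mem_zmultiples_intCast (mul_mem_zmultiples_one hc (hv _))
            (ih (n - m) (by omega) h2)
        · have hd : (p : ℤ) ∣ (2 * n).choose (2 * m) := by
            have := hp.dvd_choose_add (not_le.mp h1) (not_le.mp h2) (by omega)
            rw [← Nat.mul_add, Nat.add_sub_cancel' hm.2.le] at this
            exact_mod_cast this
          rw [mul_assoc, mul_comm]
          exact mul_mem_zmultiples_intCast (mul_mem_zmultiples_one (hv _) (hv _))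
            (by exact_mod_cast intCast_mem_zmultiples_intCast.mpr hd)
    obtain ⟨a, ha⟩ := exists_intCast_eq_romikV n
    rw [← ha] at h2 ⊢
    rw [← Int.cast_ofNat, ← Int.cast_mul, intCast_mem_zmultiples_intCast] at h2
    rw [intCast_mem_zmultiples_intCast]
    refine ((Nat.prime_iff_prime_int.mp hp).dvd_or_dvd h2).resolve_left fun hd => ?_
    have hle := Nat.le_of_dvd two_pos (by exact_mod_cast hd)
    have h4 : p % 4 = 1 := hp4
    have := hp.two_le
    omega

theorem romikVSeries_mem_truncatedHurwitzSubring {p : ℕ} [hp : Fact p.Prime]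
    (hp4 : p ≡ 1 [MOD 4]) : romikVSeries ∈ truncatedHurwitzSubring p :=
  ⟨romikVSeries_mem_hurwitzSubring, fun k hk => by
    rw [romikVSeries]
    obtain ⟨n, rfl | rfl⟩ := k.even_or_odd'
    · rw [dividedCoeff_evenSeries_two_mul]
      exact prime_dvd_romikV hp.out hp4 n hk
    · rw [dividedCoeff_evenSeries_two_mul_add_one]
      exact zero_mem _⟩

/-! ### The numbers `d(n)` as coefficients of `V` in powers of `W`. -/

open PowerSeries in
theorem iterate_romikField_romikWSeries_pow (n k : ℕ) :
    (⇑(romikField • d⁄dX ℚ))^[n] (romikWSeries ^ k) =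
      (k.descFactorial n : PowerSeries ℚ) * romikWSeries ^ (k - n) := by
  induction n with
  | zero => simp
  | succ n ih =>
    rw [Function.iterate_succ_apply', ih, Derivation.smul_apply, Derivation.leibniz,
      Derivation.map_natCast, Derivation.leibniz_pow, Nat.descFactorial_succ, smul_zero, add_zero]
    simp only [smul_eq_mul, nsmul_eq_mul]
    push_cast
    rw [Nat.sub_sub]
    linear_combination (k.descFactorial n : ℚ⟦X⟧) * ((k - n : ℕ) : ℚ⟦X⟧) *
      romikWSeries ^ (k - (n + 1)) * romikField_mul_derivative_romikWSeries

theorem localCoeff_romikWSeries_pow (n k : ℕ) :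
    localCoeff romikField n (romikWSeries ^ k) = if k = n then (n.factorial : ℚ) else 0 := by
  rw [localCoeff_apply, iterate_romikField_romikWSeries_pow, map_mul, map_pow,
    constantCoeff_romikWSeries, map_natCast]
  split_ifs with h
  · rw [h, Nat.descFactorial_self, Nat.sub_self, pow_zero, mul_one]
  · rcases lt_or_gt_of_ne h with h | h
    · rw [Nat.descFactorial_eq_zero_iff_lt.mpr h, Nat.cast_zero, zero_mul]
    · rw [zero_pow (by omega), mul_zero]

theorem romikUSeries_eq : romikUSeries = oddSeries fun j => (romikU j : ℚ) := by
  ext n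
  simp only [romikUSeries, oddSeries, PowerSeries.coeff_mk]
  split_ifs <;> simp

-- Over `ℝ`, `√2 W(X) = U(√2 X)` with `U` the series of the `u(j)`; even exponents turn the powers
-- of `√2` into powers of `2`.
open PowerSeries in
theorem coeff_two_mul_romikWSeries_pow (n k : ℕ) :
    2 ^ k * coeff (2 * n) (romikWSeries ^ (2 * k)) =
      2 ^ n * coeff (2 * n) (romikUSeries ^ (2 * k)) := by
  have hs : rescale (√2 : ℝ) (PowerSeries.map (algebraMap ℚ ℝ) romikUSeries) =
      C (√2 : ℝ) * PowerSeries.map (algebraMap ℚ ℝ) romikWSeries := by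
    ext i
    rw [coeff_rescale, coeff_C_mul, coeff_map, coeff_map, romikUSeries_eq, romikWSeries,
      coeff_eq_dividedCoeff_div, coeff_eq_dividedCoeff_div]
    obtain ⟨m, rfl | rfl⟩ := i.even_or_odd'
    · simp [dividedCoeff_oddSeries_two_mul]
    · rw [dividedCoeff_oddSeries_two_mul_add_one, dividedCoeff_oddSeries_two_mul_add_one, pow_succ,
        pow_mul, Real.sq_sqrt zero_le_two]
      push_cast
      simp
      ring
  have h := congrArg (fun x => coeff (2 * n) (x ^ (2 * k))) hs
  rw [← map_pow, ← map_pow, mul_pow, ← map_pow C, ← map_pow, coeff_rescale, coeff_C_mul, coeff_map,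
    coeff_map, pow_mul √2, pow_mul √2, Real.sq_sqrt zero_le_two] at h
  exact (algebraMap ℚ ℝ).injective (by simpa using h.symm)

open PowerSeries in
theorem coeff_odd_romikWSeries_pow (n k : ℕ) :
    coeff (2 * n + 1) (romikWSeries ^ (2 * k)) = 0 := by
  have hs : rescale (-1 : ℚ) romikWSeries = -romikWSeries := by
    ext i
    rw [coeff_rescale, map_neg, romikWSeries, coeff_eq_dividedCoeff_div]
    obtain ⟨m, rfl | rfl⟩ := i.even_or_odd'
    · simp [dividedCoeff_oddSeries_two_mul]
    · simp [pow_succ, pow_mul]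
  have h := congrArg (fun x => coeff (2 * n + 1) (x ^ (2 * k))) hs
  rw [← map_pow, coeff_rescale, Even.neg_pow (even_two_mul k)] at h
  have h1 : (-1 : ℚ) ^ (2 * n + 1) = -1 := by simp [pow_succ, pow_mul]
  rw [h1] at h
  linarith

open PowerSeries in
theorem coeff_romikWSeries_pow_of_le {n k : ℕ} (h : n ≤ k) :
    coeff n (romikWSeries ^ k) = if n = k then 1 else 0 := by
  obtain ⟨y, hy⟩ := X_dvd_iff.mpr constantCoeff_romikWSeries
  have hy0 : constantCoeff y = 1 := by
    have h1 : coeff 1 romikWSeries = 1 := by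
      rw [coeff_eq_dividedCoeff_div, romikWSeries,
        dividedCoeff_oddSeries_two_mul_add_one _ 0, romikU_eq]
      simp
    rw [hy, ← zero_add 1, coeff_succ_X_mul] at h1
    simpa using h1
  rw [hy, mul_pow, coeff_X_pow_mul']
  split_ifs with h1 h2 h2
  · simp [h2, hy0]
  · omega
  · omega
  · rfl

theorem romikS_eq_zero_of_pos {n : ℕ} (hn : 1 ≤ n) : romikS n 0 = 0 := by
  rw [romikS, mul_zero, pow_zero, PowerSeries.coeff_one, if_neg (by omega), mul_zero]

open PowerSeries in
theorem coeff_romikWSeries_pow_eq_romikS {n k : ℕ} (hk : k ≤ n) :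
    coeff (2 * n) (romikWSeries ^ (2 * k)) =
      2 ^ (n - k) * romikS n k * (2 * k).factorial / (2 * n).factorial := by
  have h := coeff_two_mul_romikWSeries_pow n k
  have h1 : ((2 * k).factorial : ℚ) ≠ 0 := by positivity
  have h2 : ((2 * n).factorial : ℚ) ≠ 0 := by positivity
  rw [romikS]
  field_simp
  rw [← Nat.add_sub_cancel' hk, pow_add] at h
  rw [Nat.add_sub_cancel' hk, mul_assoc] at h
  exact mul_left_cancel₀ (by positivity) h

-- This is the recursion for `d` rewritten as `V = ∑ d(k) W ^ (2k) / (2k)!`. Terms with `k > n` do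
-- not reach degree `2n`, and odd degrees vanish by parity.
open PowerSeries in
theorem coeff_romikVSeries_eq_sum {N j : ℕ} (hj : j < 2 * N + 1) :
    coeff j romikVSeries = ∑ k ∈ Finset.range (N + 1),
      romikD k / (2 * k).factorial * coeff j (romikWSeries ^ (2 * k)) := by
  obtain ⟨n, rfl | rfl⟩ := j.even_or_odd'
  · rw [romikVSeries, coeff_eq_dividedCoeff_div, dividedCoeff_evenSeries_two_mul]
    have hz : ∑ k ∈ Finset.Ico (n + 1) (N + 1),
        romikD k / (2 * k).factorial * coeff (2 * n) (romikWSeries ^ (2 * k)) = 0 := by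
      refine Finset.sum_eq_zero fun k hk => ?_
      rw [Finset.mem_Ico] at hk
      rw [coeff_romikWSeries_pow_of_le (by omega), if_neg (by omega), mul_zero]
    rw [Finset.range_eq_Ico, ← Finset.sum_Ico_consecutive _ (Nat.zero_le (n + 1)) (by omega), hz,
      add_zero, ← Finset.range_eq_Ico, Finset.sum_range_succ,
      coeff_romikWSeries_pow_of_le le_rfl, if_pos rfl, mul_one]
    have hs : ∑ k ∈ Finset.range n,
        romikD k / (2 * k).factorial * coeff (2 * n) (romikWSeries ^ (2 * k)) =
        (∑ k ∈ Finset.Ico 1 n, 2 ^ (n - k) * romikS n k * romikD k) / (2 * n).factorial := by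
      rw [Finset.sum_div]
      have ht : ∀ k ∈ Finset.range n,
          romikD k / (2 * k).factorial * coeff (2 * n) (romikWSeries ^ (2 * k)) =
          2 ^ (n - k) * romikS n k * romikD k / (2 * n).factorial := fun k hk => by
        rw [coeff_romikWSeries_pow_eq_romikS (Finset.mem_range.mp hk).le]
        have h1 : ((2 * k).factorial : ℚ) ≠ 0 := by positivity
        field_simp
      rw [Finset.sum_congr rfl ht]
      rcases Nat.eq_zero_or_pos n with rfl | hn
      · simp
      rw [Finset.range_eq_Ico, Finset.sum_eq_sum_Ico_succ_bot hn, romikS_eq_zero_of_pos hn]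
      simp
    rw [hs, ← add_div, romikD_eq]
    congr 1
    ring
  · rw [romikVSeries, coeff_eq_dividedCoeff_div, dividedCoeff_evenSeries_two_mul_add_one, zero_div]
    simp [coeff_odd_romikWSeries_pow]

open PowerSeries in
theorem localCoeff_romikVSeries (n : ℕ) :
    localCoeff romikField (2 * n) romikVSeries = romikD n := by
  -- A finite truncation suffices, as `D ^ (2n)` at the origin kills multiples of `X ^ (2n + 1)`.
  have hd : X ^ (2 * n + 1) ∣ romikVSeries - ∑ k ∈ Finset.range (n + 1),
      (romikD k / (2 * k).factorial) • romikWSeries ^ (2 * k) := by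
    rw [X_pow_dvd_iff]
    intro j hj
    rw [map_sub, coeff_romikVSeries_eq_sum hj, map_sum, sub_eq_zero]
    simp
  obtain ⟨y, hy⟩ := hd
  rw [eq_add_of_sub_eq hy, map_add, map_sum, pow_succ, mul_assoc, localCoeff_X_pow_mul,
    Finset.sum_eq_single n]
  · rw [map_smul, localCoeff_romikWSeries_pow, if_pos rfl]
    have h2 : ((2 * n).factorial : ℚ) ≠ 0 := by positivity
    simp [h2]
  · intro k _ hk
    rw [map_smul, localCoeff_romikWSeries_pow, if_neg (by omega), smul_zero]
  · intro h
    exact absurd (Finset.mem_range.mpr n.lt_succ_self) h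

/-! ### The multiplier modulo `p` and periodicity. -/

/-- The binomials `C(p, 2m+1)` in the recursion vanish mod `p`, leaving the product of the
`(4i+3)²`. Each `4i+3` is below `2p`, so `p` could divide it only by being equal to it, contrary to
`p ≡ 1 mod 4`. -/
theorem not_prime_dvd_romikU {p : ℕ} (hp : p.Prime) (hp4 : p ≡ 1 [MOD 4]) :
    ¬ (p : ℤ) ∣ romikU ((p - 1) / 2) := by
  have h4 : p % 4 = 1 := hp4
  have hpi := Nat.prime_iff_prime_int.mp hp
  set n := (p - 1) / 2 with hn
  have hpn : 2 * n + 1 = p := by omega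
  rw [romikU_eq, hpn]
  intro h
  have hs : (p : ℤ) ∣ ∑ m ∈ Finset.range n, (p.choose (2 * m + 1) : ℤ) *
      (∏ i ∈ Finset.range (n - m), (4 * (i : ℤ) + 1) ^ 2) * romikU m := by
    refine Finset.dvd_sum fun m hm => ?_
    rw [Finset.mem_range] at hm
    refine Dvd.dvd.mul_right (Dvd.dvd.mul_right ?_ _) _
    exact_mod_cast hp.dvd_choose_self (by omega) (by omega)
  obtain ⟨i, hi, hd⟩ := hpi.exists_mem_finset_dvd ((dvd_sub_left hs).mp h)
  have hd' : p ∣ 4 * i + 3 := by exact_mod_cast hpi.dvd_of_dvd_pow hd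
  rw [Finset.mem_range] at hi
  obtain ⟨k, hk⟩ := hd'
  have hk2 : k < 2 := by
    by_contra hk2
    have := Nat.mul_le_mul_left p (not_lt.mp hk2)
    omega
  interval_cases k <;> omega

/-- The multiplier relating coefficients `(p - 1) / 2` apart. -/
theorem exists_multiplier {p : ℕ} (hp : p.Prime) (hp4 : p ≡ 1 [MOD 4]) :
    ∃ c : ℤ, ¬ (p : ℤ) ∣ c ∧ ∀ n, 1 ≤ n →
      romikD (n + (p - 1) / 2) - c * romikD n ∈ AddSubgroup.zmultiples ((p : ℤ) : ℚ) := by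
  have : Fact p.Prime := ⟨hp⟩
  have h4 : p % 4 = 1 := hp4
  have hp1 := hp.one_lt
  have hpi := Nat.prime_iff_prime_int.mp hp
  have hV := romikVSeries_mem_truncatedHurwitzSubring (p := p) hp4
  have hF := romikField_mem (X_mem_truncatedHurwitzSubring p) hV
  obtain ⟨c, hc⟩ := mem_zmultiples_one_iff.mp
    (localCoeff_mem_zmultiples_one romikField_mem_hurwitzSubring X_mem_hurwitzSubring p)
  refine ⟨c, fun hd => ?_, fun n hn => ?_⟩
  -- Since `D W = 1`, `D ^ p W = 0`; hence `c ≡ -2 ^ ((p-1)/2) u((p-1)/2)`.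
  · have h := localCoeff_prime_modEq romikField_mem_hurwitzSubring constantCoeff_romikField hp
      romikWSeries_mem_hurwitzSubring
    have hw := localCoeff_romikWSeries_pow p 1
    rw [pow_one, if_neg hp1.ne] at hw
    have ha : dividedCoeff p romikWSeries =
        ((2 ^ ((p - 1) / 2) * romikU ((p - 1) / 2) : ℤ) : ℚ) := by
      conv_lhs => rw [show p = 2 * ((p - 1) / 2) + 1 by omega]
      rw [romikWSeries, dividedCoeff_oddSeries_two_mul_add_one]
      push_cast
      rfl
    have h1 : dividedCoeff 1 romikWSeries = 1 := by
      rw [romikWSeries, dividedCoeff_oddSeries_two_mul_add_one _ 0, romikU_eq]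
      simp
    rw [hw, ha, h1, ← hc, zero_sub, one_mul, ← Int.cast_neg, ← Int.cast_sub,
      intCast_mem_zmultiples_intCast, dvd_sub_left hd, dvd_neg] at h
    rcases hpi.dvd_or_dvd h with h | h
    · have h2 : p ∣ 2 := by exact_mod_cast hpi.dvd_of_dvd_pow h
      have := Nat.le_of_dvd two_pos h2
      omega
    · exact not_prime_dvd_romikU hp hp4 h
  · obtain ⟨m, rfl⟩ := Nat.exists_eq_add_of_le' hn
    -- With `n = m + 1`, the order is `2n - 1`: one more derivative gives `d(n)`, and `p` more give
    -- order `2 (n + (p-1)/2)`. This needs `n ≥ 1`.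
    have hx := iterate_smul_derivative_mem_truncatedHurwitzSubring hF hV (2 * m + 1)
    have h := add_mem (localCoeff_prime_modEq romikField_mem_hurwitzSubring constantCoeff_romikField
      hp hx.1) (hx.2 p le_rfl)
    have h1 : dividedCoeff 1 ((⇑(romikField • PowerSeries.derivative ℚ))^[2 * m + 1] romikVSeries) =
        romikD (m + 1) := by
      rw [← localCoeff_romikVSeries, localCoeff_apply, show 2 * (m + 1) = (2 * m + 1) + 1 by ring,
        Function.iterate_succ_apply' _ (2 * m + 1), Derivation.smul_apply, smul_eq_mul,
        map_mul PowerSeries.constantCoeff, constantCoeff_romikField, one_mul, ← dividedCoeff_zero,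
        dividedCoeff_derivative]
    have h2 : localCoeff romikField p
        ((⇑(romikField • PowerSeries.derivative ℚ))^[2 * m + 1] romikVSeries) =
        romikD (m + 1 + (p - 1) / 2) := by
      rw [← localCoeff_romikVSeries, localCoeff_apply, localCoeff_apply,
        ← Function.iterate_add_apply]
      congr 3
      omega
    rw [h1, h2, ← hc] at h
    convert h using 1
    ring

theorem exists_intCast_eq_romikD (n : ℕ) : ∃ a : ℤ, (a : ℚ) = romikD n := by
  rw [← mem_zmultiples_one_iff, ← localCoeff_romikVSeries]
  exact localCoeff_mem_zmultiples_one romikField_mem_hurwitzSubring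
    romikVSeries_mem_hurwitzSubring _

theorem mainTheorem2 :
    ∃ d : ℕ → ℤ, (∀ n : ℕ, (d n : ℚ) = romikD n) ∧
      ∀ p : ℕ, p.Prime → p ≡ 1 [MOD 4] →
        ∀ n : ℕ, 1 ≤ n → d (n + (p - 1) ^ 2 / 2) ≡ d n [ZMOD (p : ℤ)] := by
  choose d hd using exists_intCast_eq_romikD
  refine ⟨d, hd, fun p hp hp4 n hn => ?_⟩
  obtain ⟨c, hc, hdc⟩ := exists_multiplier hp hp4
  have hstep : ∀ n, 1 ≤ n → d (n + (p - 1) / 2) ≡ c * d n [ZMOD (p : ℤ)] := fun n hn => by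
    have h := hdc n hn
    rw [← hd, ← hd, ← Int.cast_mul, ← Int.cast_sub, intCast_mem_zmultiples_intCast] at h
    exact (Int.modEq_iff_dvd.mpr h).symm
  have hiter : ∀ k, d (n + k * ((p - 1) / 2)) ≡ c ^ k * d n [ZMOD (p : ℤ)] := fun k => by
    induction k with
    | zero => simp
    | succ k ih =>
      rw [Nat.succ_mul, ← add_assoc, pow_succ', mul_assoc]
      exact (hstep _ (by omega)).trans (ih.mul_left c)
  have hcop : IsCoprime c (p : ℤ) :=
    ((Nat.prime_iff_prime_int.mp hp).irreducible.coprime_iff_not_dvd.mpr hc).symm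
  have h4 : p % 4 = 1 := hp4
  have heq : (p - 1) ^ 2 / 2 = (p - 1) * ((p - 1) / 2) := by
    rw [sq, Nat.mul_div_assoc _ (by omega)]
  rw [heq]
  simpa using (hiter (p - 1)).trans ((Int.ModEq.pow_card_sub_one_eq_one hp hcop).mul_right (d n))
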